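/- The mirror game on $\{1,\dots,2n\}$ lasts $2n$ turns. Alice plays in the odd turns and Bob in the even turns; each turn the player declares a number from $\{1,\dots,2n\}$. The first player who declares a number that has already been declared loses; if no number is repeated, the game is a draw. An open-book strategy of Alice with $m$ bits of memory starts from some memory state in $\{0,1\}^m$. Before each of her moves Alice draws a fresh uniformly random string in $\{0,1\}^\ell$ ($\ell$ is arbitrary), and all strings drawn so far stay available to her. In each of her turns except the first she computes a new memory state from her current memory state, Bob's last move, the number of the turn and the strings drawn so far. In each of her turns her move is a function of her current memory state and the strings drawn so far. Bob knows Alice's strategy; when he moves he knows all previous moves, Alice's memory state and all random strings drawn so far, but not the future ones. His choice may be randomized. A function $\nu:\mathbb N\to\mathbb R$ is negligible if for every integer $k\ge 1$ there is $N_k$ such that $|\nu(x)|<x^{-k}$ for all $x>N_k$. **Theorem.** Let $c\ge 2$ be an even integer, let $\left(\frac1c\right)^{1/(4c)}<\beta<1$, and let $\delta\in(0,1)$ satisfy $2^{\delta}\beta<1$. There is a negligible function $\nu$, depending only on $c,\beta,\delta$, such that for every $n\ge 1$ for which $n/c$ is an even integer, every $m\le \delta\cdot 2n$, every $\ell$,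 and every open-book strategy of Alice with $m$ bits of memory and random strings of length $\ell$, there is a strategy of Bob against which Alice loses with probability at least $$1-\left(\frac{n+1}{2n+1}\right)^{c/2}-\nu(n).$$ -/

import Mathlib

/-- A function on the naturals is negligible if it is eventually smaller in absolute value than
the inverse of every positive power. -/
def Negligible (f : ℕ → ℝ) : Prop :=
  ∀ k : ℕ, 0 < k → ∃ N : ℕ, ∀ x : ℕ, N < x → |f x| < 1 / (x : ℝ) ^ k

namespace MirrorGame

/-- Bit strings of length `ℓ`. -/
abbrev Bits (ℓ : ℕ) : Type := Fin ℓ → Bool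

/-- The numbers available in the game: a copy of `{1, …, 2n}`. -/
abbrev Number (n : ℕ) : Type := Fin (2 * n)

/-- A strategy of Alice with `m` bits of memory that draws `ℓ` fresh random bits before each of
her moves. The list argument consists of all random strings drawn so far, oldest first; all of
them stay available to her for free. Its length tells her the number of the turn. -/
structure AliceStrategy (n m ℓ : ℕ) where
  /-- initial memory state -/
  init : Bits m
  /-- next move, from the current memory state and the random strings drawn so far -/
  nxt : Bits m → List (Bits ℓ) → Number n
  /-- new memory state, from the last move of Bob, the current memory state and the random strings
  drawn so far -/
  upd : Number n → Bits m → List (Bits ℓ) → Bits m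

/-- A randomized strategy of Bob: the law of his next move, given all random strings that Alice has
drawn so far (but no future ones) and all moves made so far, oldest first. For a given strategy of
Alice these data determine her memory state, so Bob sees her memory too. -/
abbrev BobStrategy (n ℓ : ℕ) : Type := List (Bits ℓ) → List (Number n) → PMF (Number n)

/-- The situation between two rounds. -/
structure State (n m ℓ : ℕ) where
  /-- random strings drawn so far, oldest first -/
  rand : List (Bits ℓ)
  /-- moves made so far, oldest first -/
  moves : List (Number n)
  /-- memory state of Alice -/
  mem : Bits m

variable {n m ℓ : ℕ}

/-- The beginning of a round, once Alice has drawn `r`: she updates her memory with the last move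
of Bob (there is none in the first round) and then makes her move. -/
def aliceTurn (A : AliceStrategy n m ℓ) (s : State n m ℓ) (r : Bits ℓ) : State n m ℓ :=
  let rand := s.rand ++ [r]
  let mem := match s.moves.getLast? with
    | none => s.mem
    | some b => A.upd b s.mem rand
  { rand := rand, moves := s.moves ++ [A.nxt mem rand], mem := mem }

/-- One round: Alice draws uniform random bits and moves, then Bob, who sees these bits, moves. -/
noncomputable def round (A : AliceStrategy n m ℓ) (B : BobStrategy n ℓ) (s : State n m ℓ) :
    PMF (State n m ℓ) :=
  (PMF.uniformOfFintype (Bits ℓ)).bind fun r =>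
    let s' := aliceTurn A s r
    (B s'.rand s'.moves).map fun b => { s' with moves := s'.moves ++ [b] }

/-- The law of the situation after a given number of rounds. -/
noncomputable def play (A : AliceStrategy n m ℓ) (B : BobStrategy n ℓ) : ℕ → PMF (State n m ℓ)
  | 0 => PMF.pure { rand := [], moves := [], mem := A.init }
  | k + 1 => (play A B k).bind (round A B)

/-- Alice loses if the first repetition of a number is made by her. Her turns are the entries at
the even positions, counted from `0`. (Moves after the first repetition play no role.) -/
def AliceLoses (h : List (Number n)) : Prop :=
  ∃ i : ℕ, Even i ∧ (h.take i).Nodup ∧ ∃ a ∈ h[i]?, a ∈ h.take i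

/-- The probability that Alice loses the game, which has `n` rounds (`2n` turns), over the random
bits of both players. -/
noncomputable def probAliceLoses (A : AliceStrategy n m ℓ) (B : BobStrategy n ℓ) : ℝ :=
  ((play A B n).toOuterMeasure {s | AliceLoses s.moves}).toReal

end MirrorGame

/-! Alice's later moves depend on the past only through her memory state, the strings drawn and
Bob's last move. Bob can therefore reason about several "worlds" at once: sets of declared numbers
that all leave her in the same situation. Suppose he always answers outside every world not yet hit
by her moves. Then she repeats a number in the worlds she hits, and he is safe in the others. If the
unions of worlds have even size, such an answer always exists. At the end a surviving world must be
the complement of everything said since, so at most one survives: the failure probabilities, summed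
over the worlds, are at most 1 (`failSum_le_one`).

Worlds are created in `s = c / 2` phases of `T = n / (2c)` rounds, in which Bob answers uniformly
among the numbers outside all worlds. Once the strings are fixed, a given set of `2T` declared
numbers arises with probability at most `(2T / n) ^ T = c ^ (-T)`, while there are only `2 ^ m * (2n
+ 1)` situations of Alice and boundedly many families of surviving worlds. Among more than `2n + 1`
sets of even size two have an even union (`card_le_of_even_of_odd_inter`), so up to a small error
the sets leading to one situation can be matched in such pairs (`sum_mul_le_of_exists_pair`). A pair
doubles the worlds, so each phase halves the average failure (`phase_failSum_le`). Hence Bob fails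
with probability at most `2 ^ (-s)` plus an error of order `(2n + 1) ^ 2 * (2 ^ δ * β) ^ (2n)`. -/

section

open Finset

/-! ### Two combinatorial lemmas: parity of intersections and weighted matching -/

/-- Finite sets of even size whose pairwise intersections have odd size: there are at most
`card α + 1` of them. -/
theorem card_le_of_even_of_odd_inter {α : Type*} [Fintype α] [DecidableEq α]
    (Y : Finset (Finset α)) (heven : ∀ Q ∈ Y, Even #Q)
    (hodd : ∀ Q₁ ∈ Y, ∀ Q₂ ∈ Y, Q₁ ≠ Q₂ → Odd #(Q₁ ∩ Q₂)) :
    #Y ≤ Fintype.card α + 1 := by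
  -- The extra coordinate, always 1, turns odd intersections into orthogonality and even sizes into
  -- norm 1; orthonormal vectors over `ZMod 2` are independent.
  let v : Y → Option α → ZMod 2 := fun Q o => o.elim 1 fun a => if a ∈ Q.1 then 1 else 0
  have hdot : ∀ Q₁ Q₂ : Y, ∑ o, v Q₁ o * v Q₂ o = 1 + (#(Q₁.1 ∩ Q₂.1) : ZMod 2) := by
    intro Q₁ Q₂
    rw [Fintype.sum_option]
    simp only [v, Option.elim, mul_one, ← ite_and, mul_ite, mul_zero]
    rw [Finset.sum_boole]
    congr 3
    ext a
    simp [and_comm]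
  have hself : ∀ Q : Y, ∑ o, v Q o * v Q o = 1 := fun Q => by
    rw [hdot, inter_self, (ZMod.natCast_eq_zero_iff_even).2 (heven _ Q.2), add_zero]
  have hne : ∀ Q₁ Q₂ : Y, Q₁ ≠ Q₂ → ∑ o, v Q₁ o * v Q₂ o = 0 := fun Q₁ Q₂ h => by
    rw [hdot, (ZMod.natCast_eq_one_iff_odd).2
      (hodd _ Q₁.2 _ Q₂.2 fun h' => h (Subtype.ext h'))]
    decide
  have hli : LinearIndependent (ZMod 2) v := by
    rw [Fintype.linearIndependent_iff]
    intro g hg Q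
    have h0 : ∑ o, (∑ R, g R • v R) o * v Q o = 0 := by rw [hg]; simp only [Pi.zero_apply, zero_mul, sum_const_zero]
    have h1 : ∑ o, (∑ R, g R • v R) o * v Q o = ∑ R, g R * ∑ o, v R o * v Q o := by
      simp only [Finset.sum_apply, Pi.smul_apply, smul_eq_mul, Finset.sum_mul, Finset.mul_sum]
      rw [Finset.sum_comm]
      simp only [mul_assoc]
    rw [h1, Finset.sum_eq_single Q (fun R _ hR => by rw [hne R Q hR, mul_zero]) (by simp),
      hself, mul_one] at h0
    exact h0
  have h := hli.fintype_card_le_finrank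
  simpa [Module.finrank_fintype_fun_eq_card] using h

/-- If every large enough subset contains two elements at which the sum of `g` is at most `a`, then
`g` has weighted sum at most `a / 2`, up to the weight of few elements. -/
theorem sum_mul_le_of_exists_pair {ι : Type*} [DecidableEq ι] (X : Finset ι) (g : ι → ℝ)
    (K : ℕ) {a b ω : ℝ} (ha : 0 ≤ a) (hω : 0 ≤ ω) (hb : 0 ≤ b) (hgb : ∀ i ∈ X, g i ≤ b)
    (hpair : ∀ Y ⊆ X, K < #Y → ∃ i ∈ Y, ∃ j ∈ Y, i ≠ j ∧ g i + g j ≤ a) :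
    ∀ w : ι → ℝ, (∀ i ∈ X, 0 ≤ w i) → (∀ i ∈ X, w i ≤ ω) →
      ∑ i ∈ X, w i * g i ≤ a / 2 * ∑ i ∈ X, w i + K * ω * b := by
  intro w
  induction hN : #{i ∈ X | w i ≠ 0} using Nat.strong_induction_on generalizing w with
  | _ N ih =>
  intro hw hwω
  by_cases hK : #{i ∈ X | w i ≠ 0} ≤ K
  · have h1 : ∑ i ∈ X, w i * g i = ∑ i ∈ X with w i ≠ 0, w i * g i := by
      rw [Finset.sum_filter]
      refine Finset.sum_congr rfl fun i _ => ?_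
      split_ifs with h
      · rfl
      · simp [not_not.1 h]
    have h2 : ∑ i ∈ X with w i ≠ 0, w i * g i ≤ ∑ i ∈ X with w i ≠ 0, ω * b := by
      refine Finset.sum_le_sum fun i hi => ?_
      have hi' := (mem_filter.1 hi).1
      exact (mul_le_mul_of_nonneg_left (hgb i hi') (hw i hi')).trans
        (mul_le_mul_of_nonneg_right (hwω i hi') hb)
    have h3 : (∑ i ∈ X with w i ≠ 0, ω * b) ≤ K * ω * b := by
      rw [Finset.sum_const, nsmul_eq_mul, mul_assoc]
      exact mul_le_mul_of_nonneg_right (by exact_mod_cast hK) (mul_nonneg hω hb)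
    have h4 : 0 ≤ a / 2 * ∑ i ∈ X, w i := mul_nonneg (by linarith) (Finset.sum_nonneg hw)
    linarith
  · obtain ⟨p, hp, q, hq, hpq, hga⟩ := hpair _ (filter_subset _ _) (not_le.1 hK)
    obtain ⟨hpX, hp0⟩ := mem_filter.1 hp
    obtain ⟨hqX, hq0⟩ := mem_filter.1 hq
    -- Taking `d` off both weights kills one of them, so the support shrinks; the part removed
    -- contributes `d * (g p + g q) ≤ a / 2 * (2 * d)`.
    set d := min (w p) (w q) with hd
    have hd0 : 0 ≤ d := le_min (hw p hpX) (hw q hqX)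
    let w' : ι → ℝ := fun i => w i - ((if i = p then d else 0) + if i = q then d else 0)
    have hw'p : w' p = w p - d := by simp [w', hpq]
    have hw'q : w' q = w q - d := by simp [w', hpq.symm]
    have hw'o : ∀ i, i ≠ p → i ≠ q → w' i = w i := fun i h1 h2 => by simp [w', h1, h2]
    have hw'0 : ∀ i ∈ X, 0 ≤ w' i := by
      intro i hi
      rcases eq_or_ne i p with rfl | h1
      · rw [hw'p]; linarith [min_le_left (w i) (w q)]
      rcases eq_or_ne i q with rfl | h2
      · rw [hw'q]; linarith [min_le_right (w p) (w i)]
      rw [hw'o i h1 h2]; exact hw i hi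
    have hw'le : ∀ i ∈ X, w' i ≤ ω := by
      intro i hi
      refine le_trans ?_ (hwω i hi)
      have : 0 ≤ (if i = p then d else 0) + if i = q then d else 0 := by positivity
      simp only [w']; linarith
    have hlt : #{i ∈ X | w' i ≠ 0} < N := by
      rw [← hN]
      refine Finset.card_lt_card ⟨fun i hi => ?_, fun hsub => ?_⟩
      · obtain ⟨hiX, hi0⟩ := mem_filter.1 hi
        refine mem_filter.2 ⟨hiX, fun h => ?_⟩
        rcases eq_or_ne i p with rfl | h1
        · exact hp0 h
        rcases eq_or_ne i q with rfl | h2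
        · exact hq0 h
        exact hi0 (by rw [hw'o i h1 h2, h])
      · rcases min_choice (w p) (w q) with h | h
        · exact (mem_filter.1 (hsub hp)).2 (by rw [hw'p, hd, h, sub_self])
        · exact (mem_filter.1 (hsub hq)).2 (by rw [hw'q, hd, h, sub_self])
    have key := ih _ hlt w' rfl hw'0 hw'le
    have e1 : ∑ i ∈ X, w i = ∑ i ∈ X, w' i + 2 * d := by
      simp only [w', Finset.sum_sub_distrib, Finset.sum_add_distrib, Finset.sum_ite_eq', hpX, hqX,
        if_true]
      ring
    have e2 : ∑ i ∈ X, w i * g i = ∑ i ∈ X, w' i * g i + d * (g p + g q) := by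
      simp only [w', sub_mul, add_mul, ite_mul, zero_mul, Finset.sum_sub_distrib,
        Finset.sum_add_distrib, Finset.sum_ite_eq', hpX, hqX, if_true]
      ring
    rw [e1, e2]
    nlinarith [mul_le_mul_of_nonneg_left hga hd0]

/-! ### Families of worlds and their parity -/

/-- Families of sets obtained by choosing one set from each of several pairs of sets of even size
with unions of even size, the unions for different pairs being disjoint. -/
inductive GoodFamily {α : Type*} [DecidableEq α] : Finset (Finset α) → Prop
  | empty : GoodFamily ∅
  | singleton : GoodFamily {∅}
  | pair {F : Finset (Finset α)} {Q₁ Q₂ : Finset α} : GoodFamily F → Even #(Q₁ ∪ Q₂) →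
      Even #Q₁ → Even #Q₂ → Disjoint Q₁ (F.sup id) → Disjoint Q₂ (F.sup id) →
      GoodFamily (F.image (· ∪ Q₁) ∪ F.image (· ∪ Q₂))

namespace GoodFamily

variable {α : Type*} [DecidableEq α]

theorem sup_image_union_le (F : Finset (Finset α)) (Q₁ Q₂ : Finset α) :
    (F.image (· ∪ Q₁) ∪ F.image (· ∪ Q₂)).sup id ⊆ F.sup id ∪ (Q₁ ∪ Q₂) := by
  intro x hx
  simp only [mem_sup, mem_union, mem_image, id] at hx ⊢
  rcases hx with ⟨_, ⟨P, hP, rfl⟩ | ⟨P, hP, rfl⟩, hx⟩ <;> rcases mem_union.1 hx with h | h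
  · exact Or.inl ⟨P, hP, h⟩
  · exact Or.inr (Or.inl h)
  · exact Or.inl ⟨P, hP, h⟩
  · exact Or.inr (Or.inr h)

theorem sup_image_union (F : Finset (Finset α)) (hF : F.Nonempty) (Q₁ Q₂ : Finset α) :
    (F.image (· ∪ Q₁) ∪ F.image (· ∪ Q₂)).sup id = F.sup id ∪ (Q₁ ∪ Q₂) := by
  refine (sup_image_union_le F Q₁ Q₂).antisymm fun x hx => ?_
  obtain ⟨P₀, hP₀⟩ := hF
  simp only [mem_sup, mem_union, mem_image, id] at hx ⊢
  rcases hx with ⟨P, hP, h⟩ | h | h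
  · exact ⟨_, Or.inl ⟨P, hP, rfl⟩, mem_union_left _ h⟩
  · exact ⟨_, Or.inl ⟨P₀, hP₀, rfl⟩, mem_union_right _ h⟩
  · exact ⟨_, Or.inr ⟨P₀, hP₀, rfl⟩, mem_union_right _ h⟩

/-- This parity is what leaves Bob a free answer in `failSum_le_one`. -/
theorem even_card_sup {F : Finset (Finset α)} (hF : GoodFamily F) : Even #(F.sup id) := by
  induction hF with
  | empty => simp
  | singleton => simp
  | @pair F Q₁ Q₂ _ h _ _ h₁ h₂ ih =>
    rcases F.eq_empty_or_nonempty with rfl | hne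
    · simp
    rw [sup_image_union F hne, card_union_of_disjoint (disjoint_union_right.2 ⟨h₁.symm, h₂.symm⟩)]
    exact ih.add h

theorem sup_filter_subset (F : Finset (Finset α)) (p : Finset α → Prop) [DecidablePred p] :
    (F.filter p).sup id ⊆ F.sup id :=
  Finset.sup_mono (filter_subset _ _)

/-- If `x` hits just one set of a pair, the other one paired with itself remains. This is why a pair
may be degenerate and why the sets themselves, not only their union, must be even. -/
theorem filter_notMem {F : Finset (Finset α)} (hF : GoodFamily F) (x : α) :
    GoodFamily {P ∈ F | x ∉ P} := by
  induction hF with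
  | empty => exact .empty
  | singleton => rw [filter_true_of_mem (by simp)]; exact .singleton
  | @pair F Q₁ Q₂ hF h e₁ e₂ h₁ h₂ ih =>
    have hpos : ∀ Q : Finset α, x ∈ Q → {P ∈ F.image (· ∪ Q) | x ∉ P} = ∅ := by
      intro Q hx
      refine filter_eq_empty_iff.2 fun P hP => ?_
      obtain ⟨P', _, rfl⟩ := mem_image.1 hP
      exact not_not.2 (mem_union_right _ hx)
    have hneg : ∀ Q : Finset α, x ∉ Q →
        {P ∈ F.image (· ∪ Q) | x ∉ P} = {P ∈ F | x ∉ P}.image (· ∪ Q) := by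
      intro Q hx
      rw [filter_image]
      simp [hx]
    have hd : ∀ Q : Finset α, Disjoint Q (F.sup id) → Disjoint Q ({P ∈ F | x ∉ P}.sup id) :=
      fun Q hQ => hQ.mono_right (sup_filter_subset _ _)
    rw [filter_union]
    by_cases x₁ : x ∈ Q₁ <;> by_cases x₂ : x ∈ Q₂
    · rw [hpos _ x₁, hpos _ x₂, empty_union]; exact .empty
    · rw [hpos _ x₁, hneg _ x₂, empty_union, ← union_self (image _ _)]
      exact .pair ih (by rwa [union_self]) e₂ e₂ (hd _ h₂) (hd _ h₂)
    · rw [hpos _ x₂, hneg _ x₁, union_empty, ← union_self (image _ _)]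
      exact .pair ih (by rwa [union_self]) e₁ e₁ (hd _ h₁) (hd _ h₁)
    · rw [hneg _ x₁, hneg _ x₂]
      exact .pair ih h e₁ e₂ (hd _ h₁) (hd _ h₂)

end GoodFamily

/-! ### Playing against all worlds at once -/

/-- A player who answers from a memory state in `M` and the random data in `Ω` drawn so far. -/
structure Responder (Ω M α : Type*) where
  /-- the move -/
  act : List Ω → M → α
  /-- the memory state after the reply of the opponent -/
  next : List Ω → M → α → M

namespace Responder

variable {Ω M α : Type*} [DecidableEq α]

/-- The least probability with which the opponent of `A` can fail to make `A` repeat a number in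
the next rounds, when the numbers in `P` have been declared. -/
noncomputable def fail [Fintype Ω] (A : Responder Ω M α) : ℕ → List Ω → M → Finset α → ℝ
  | 0, _, _, _ => 1
  | k + 1, R, μ, P => (∑ ω, if A.act (R ++ [ω]) μ ∈ P then 0 else
      ⨅ b, if b ∈ insert (A.act (R ++ [ω]) μ) P then 1 else
        A.fail k (R ++ [ω]) (A.next (R ++ [ω]) μ b) (insert b (insert (A.act (R ++ [ω]) μ) P))) /
      Fintype.card Ω

theorem fail_nonneg [Fintype Ω] (A : Responder Ω M α) (k : ℕ) (R : List Ω) (μ : M) (P : Finset α) :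
    0 ≤ A.fail k R μ P := by
  induction k generalizing R μ P with
  | zero => simp [fail]
  | succ k ih =>
    rw [fail]
    refine div_nonneg (Finset.sum_nonneg fun ω _ => ?_) (Nat.cast_nonneg _)
    split_ifs
    · rfl
    · refine Real.iInf_nonneg fun b => ?_
      split_ifs
      · exact zero_le_one
      · exact ih _ _ _

theorem fail_le_one [Fintype Ω] [Fintype α] (A : Responder Ω M α) (k : ℕ) (R : List Ω) (μ : M) (P : Finset α) :
    A.fail k R μ P ≤ 1 := by
  induction k generalizing R μ P with
  | zero => simp [fail]
  | succ k ih =>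
    rw [fail]
    refine div_le_one_of_le₀ ?_ (Nat.cast_nonneg _)
    refine (Finset.sum_le_card_nsmul _ _ 1 fun ω _ => ?_).trans (by simp)
    split_ifs
    · exact zero_le_one
    -- Repeating the number just declared scores 1, which caps the infimum.
    · refine (ciInf_le (Set.finite_range _).bddBelow (A.act (R ++ [ω]) μ)).trans ?_
      simp

/-- The sum of the failure probabilities when a member of `F` and the elements of `Q` have been
declared. -/
noncomputable def failSum [Fintype Ω] (A : Responder Ω M α) (k : ℕ) (R : List Ω) (μ : M)
    (F : Finset (Finset α)) (Q : Finset α) : ℝ :=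
  ∑ P ∈ F, A.fail k R μ (P ∪ Q)

theorem failSum_nonneg [Fintype Ω] (A : Responder Ω M α) (k : ℕ) (R : List Ω) (μ : M)
    (F : Finset (Finset α)) (Q : Finset α) : 0 ≤ A.failSum k R μ F Q :=
  Finset.sum_nonneg fun _ _ => A.fail_nonneg _ _ _ _

theorem failSum_le_card [Fintype Ω] [Fintype α] (A : Responder Ω M α) (k : ℕ) (R : List Ω) (μ : M)
    (F : Finset (Finset α)) (Q : Finset α) : A.failSum k R μ F Q ≤ #F :=
  (Finset.sum_le_card_nsmul _ _ 1 fun _ _ => A.fail_le_one _ _ _ _).trans (by simp)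

/-- If for each random draw the opponent has a safe reply after which `failSum` is at most `g`,
then `failSum` is at most the mean of `g`. -/
theorem failSum_succ_le [Fintype Ω] [Fintype α] (A : Responder Ω M α) (k : ℕ) (R : List Ω) (μ : M)
    (F : Finset (Finset α)) (Q : Finset α) (g : Ω → ℝ) (hg : ∀ ω, 0 ≤ g ω)
    (h : ∀ ω, A.act (R ++ [ω]) μ ∉ Q →
      ∃ b, b ∉ {P ∈ F | A.act (R ++ [ω]) μ ∉ P}.sup id ∪ insert (A.act (R ++ [ω]) μ) Q ∧
        A.failSum k (R ++ [ω]) (A.next (R ++ [ω]) μ b) {P ∈ F | A.act (R ++ [ω]) μ ∉ P}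
          (insert b (insert (A.act (R ++ [ω]) μ) Q)) ≤ g ω) :
    A.failSum (k + 1) R μ F Q ≤ (∑ ω, g ω) / Fintype.card Ω := by
  unfold failSum
  simp only [fail]
  rw [← Finset.sum_div, Finset.sum_comm]
  refine div_le_div_of_nonneg_right (Finset.sum_le_sum fun ω _ => ?_) (Nat.cast_nonneg _)
  by_cases hQ : A.act (R ++ [ω]) μ ∈ Q
  · rw [Finset.sum_eq_zero fun P _ => if_pos (mem_union_right _ hQ)]
    exact hg ω
  -- The single reply `b` bounds the infimum in every surviving world; the worlds containing Alice's
  -- move contribute zero.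
  obtain ⟨b, hb, hbg⟩ := h ω hQ
  refine le_trans ?_ hbg
  rw [failSum, Finset.sum_filter]
  refine Finset.sum_le_sum fun P hP => ?_
  by_cases hx : A.act (R ++ [ω]) μ ∈ P
  · simp [hx]
  have hx' : A.act (R ++ [ω]) μ ∉ P ∪ Q := by simp [hx, hQ]
  rw [if_neg hx', if_pos hx]
  refine (ciInf_le (Set.finite_range _).bddBelow b).trans (le_of_eq ?_)
  simp only [mem_union, mem_sup, mem_filter, not_or, id] at hb
  have hbP : b ∉ P := fun hbP => hb.1 ⟨P, ⟨hP, hx⟩, hbP⟩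
  have hbQ : b ∉ insert (A.act (R ++ [ω]) μ) (P ∪ Q) := by
    have := hb.2
    simp only [mem_insert, mem_union, not_or] at this ⊢
    exact ⟨this.1, hbP, this.2⟩
  rw [if_neg hbQ]
  congr 1
  ext y
  simp only [mem_insert, mem_union]
  tauto

theorem card_sup_union_insert_le (F : Finset (Finset α)) (Q : Finset α) (x : α) :
    #({P ∈ F | x ∉ P}.sup id ∪ insert x Q) ≤ #(F.sup id) + #Q + 1 := by
  refine (card_union_le _ _).trans ?_
  have h1 := card_le_card (GoodFamily.sup_filter_subset F (x ∉ ·))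
  have h2 := card_insert_le x Q
  omega

theorem disjoint_insert_insert {F : Finset (Finset α)} {Q : Finset α} {x b : α}
    (hd : Disjoint Q (F.sup id)) (hb : b ∉ {P ∈ F | x ∉ P}.sup id ∪ insert x Q) :
    Disjoint (insert b (insert x Q)) ({P ∈ F | x ∉ P}.sup id) := by
  rw [disjoint_insert_left, disjoint_insert_left]
  refine ⟨fun h => hb (mem_union_left _ h), ?_,
    hd.mono_right (GoodFamily.sup_filter_subset _ _)⟩
  simp [mem_sup]

theorem card_insert_insert {F : Finset (Finset α)} {Q : Finset α} {x b : α}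
    (hx : x ∉ Q) (hb : b ∉ F.sup id ∪ insert x Q) :
    #(insert b (insert x Q)) = #Q + 2 := by
  rw [card_insert_of_notMem fun h => hb (mem_union_right _ h), card_insert_of_notMem hx]

/-- The opponent can play such that at most one world survives. -/
theorem failSum_le_one [Fintype Ω] [Fintype α] (A : Responder Ω M α) [Nonempty Ω] (hα : Even (Fintype.card α)) (k : ℕ)
    (R : List Ω) (μ : M) (F : Finset (Finset α)) (Q : Finset α) (hF : GoodFamily F)
    (hd : Disjoint Q (F.sup id)) (hQ : Even #Q)
    (hc : ∀ P ∈ F, #P + #Q + 2 * k = Fintype.card α) : A.failSum k R μ F Q ≤ 1 := by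
  induction k generalizing R μ F Q with
  | zero =>
    refine (A.failSum_le_card _ _ _ _ _).trans ?_
    -- With no rounds left the size condition makes every world the whole complement of `Q`.
    have hsub : F ⊆ {Qᶜ} := by
      intro P hP
      have hPQ : Disjoint P Q := (hd.mono_right (Finset.le_sup (f := id) hP)).symm
      refine mem_singleton.2 (Finset.eq_of_subset_of_card_le ?_ ?_)
      · exact fun a ha => mem_compl.2 (Finset.disjoint_left.1 hPQ ha)
      · rw [card_compl]
        have := hc P hP
        omega
    exact_mod_cast (card_le_card hsub).trans (by simp)
  | succ k ih =>
    refine (A.failSum_succ_le k R μ F Q (fun _ => 1) (fun _ => zero_le_one) fun ω hx => ?_).trans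
      (by simp)
    set x := A.act (R ++ [ω]) μ
    have hF' := hF.filter_notMem x
    obtain ⟨b, hb⟩ : ∃ b, b ∉ {P ∈ F | x ∉ P}.sup id ∪ insert x Q := by
      -- Otherwise the union of the worlds, of even size, and `insert x Q`, of odd size, would
      -- partition a set of even size.
      by_contra! hall
      have h1 : {P ∈ F | x ∉ P}.sup id ∪ insert x Q = univ := eq_univ_of_forall hall
      have h2 : Disjoint ({P ∈ F | x ∉ P}.sup id) (insert x Q) := by
        refine Disjoint.symm (disjoint_insert_left.2 ⟨by simp [mem_sup], ?_⟩)
        exact hd.mono_right (GoodFamily.sup_filter_subset _ _)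
      have h3 := card_union_of_disjoint h2
      rw [h1, card_univ, card_insert_of_notMem hx] at h3
      have h4 := hF'.even_card_sup
      rw [h3] at hα
      grind
    refine ⟨b, hb, ih _ _ _ _ hF' (disjoint_insert_insert hd hb) ?_ fun P hP => ?_⟩
    · rw [card_insert_insert hx hb]
      exact hQ.add even_two
    · rw [card_insert_insert hx hb]
      have := hc P (mem_filter.1 hP).1
      omega

/-! ### Phases of uniformly random replies -/

/-- The mean over the lists of `T` random draws. -/
noncomputable def iterMean [Fintype Ω] : ℕ → (List Ω → ℝ) → ℝ
  | 0, f => f []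
  | T + 1, f => (∑ ω, iterMean T fun w => f (ω :: w)) / Fintype.card Ω

theorem iterMean_le [Fintype Ω] [Nonempty Ω] (T : ℕ) (f : List Ω → ℝ) (C : ℝ)
    (h : ∀ w, w.length = T → f w ≤ C) : iterMean T f ≤ C := by
  induction T generalizing f with
  | zero => exact h [] rfl
  | succ T ih =>
    rw [iterMean, div_le_iff₀ (by exact_mod_cast Fintype.card_pos)]
    refine (Finset.sum_le_card_nsmul _ _ C fun ω _ =>
      ih _ fun w hw => h _ (by simp [hw])).trans ?_
    simp [mul_comm]

theorem iterMean_zero [Fintype Ω] (T : ℕ) : iterMean T (fun _ : List Ω => 0) = 0 := by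
  induction T with
  | zero => rfl
  | succ T ih => simp [iterMean, ih]

theorem iterMean_sum [Fintype Ω] {ι : Type*} (S : Finset ι) (d : ℝ) (T : ℕ) (f : ι → List Ω → ℝ) :
    iterMean T (fun w => (∑ b ∈ S, f b w) / d) = (∑ b ∈ S, iterMean T (f b)) / d := by
  induction T generalizing f with
  | zero => rfl
  | succ T ih =>
    simp only [iterMean, ih]
    simp only [← Finset.sum_div]
    rw [Finset.sum_comm, div_right_comm]

/-- The numbers outside all worlds of `F` that do not contain `x`, outside `Q` and different
from `x`. -/
def avail [Fintype α] (F : Finset (Finset α)) (Q : Finset α) (x : α) : Finset α :=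
  ({P ∈ F | x ∉ P}.sup id ∪ insert x Q)ᶜ

theorem le_card_avail [Fintype α] {F : Finset (Finset α)} {Q : Finset α} {n : ℕ} (x : α)
    (h : #(F.sup id) + #Q + 1 + n ≤ Fintype.card α) : n ≤ #(avail F Q x) := by
  rw [avail, card_compl]
  have := card_sup_union_insert_le F Q x
  omega

/-- The expectation of `f` after the random draws `w`, when the opponent always chooses uniformly
among the available numbers. Repetitions by the responder in all worlds contribute zero. -/
noncomputable def phase [Fintype α] (A : Responder Ω M α) (f : M → Finset (Finset α) → Finset α → ℝ) :
    List Ω → List Ω → M → Finset (Finset α) → Finset α → ℝ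
  | [], _, μ, F, Q => f μ F Q
  | ω :: w, R, μ, F, Q => if A.act (R ++ [ω]) μ ∈ Q then 0 else
      (∑ b ∈ avail F Q (A.act (R ++ [ω]) μ),
        A.phase f w (R ++ [ω]) (A.next (R ++ [ω]) μ b) {P ∈ F | A.act (R ++ [ω]) μ ∉ P}
          (insert b (insert (A.act (R ++ [ω]) μ) Q))) /
      #(avail F Q (A.act (R ++ [ω]) μ))

theorem phase_nonneg [Fintype α] (A : Responder Ω M α) {f : M → Finset (Finset α) → Finset α → ℝ}
    (hf : ∀ μ F Q, 0 ≤ f μ F Q) (w R : List Ω) (μ : M) (F : Finset (Finset α)) (Q : Finset α) :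
    0 ≤ A.phase f w R μ F Q := by
  induction w generalizing R μ F Q with
  | nil => exact hf _ _ _
  | cons ω w ih =>
    rw [phase]
    split_ifs
    · rfl
    · exact div_nonneg (Finset.sum_nonneg fun b _ => ih _ _ _ _) (Nat.cast_nonneg _)

/-- Bob's uniform replies ignore future strings, so the mean over the strings of the whole phase can
be pulled outside. Inside, the strings are fixed and only Bob's choices are random; hence Alice's
randomness does not count as memory. -/
theorem failSum_le_iterMean_phase [Fintype Ω] [Fintype α] (A : Responder Ω M α) (k T : ℕ) {n : ℕ} (hn : 0 < n)
    (R : List Ω) (μ : M) (F : Finset (Finset α)) (Q : Finset α)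
    (h : #(F.sup id) + #Q + 2 * T + n ≤ Fintype.card α) :
    A.failSum (k + T) R μ F Q ≤
      iterMean T fun w => A.phase (A.failSum k (R ++ w)) w R μ F Q := by
  induction T generalizing R μ F Q with
  | zero => simp [iterMean, phase]
  | succ T ih =>
    rw [iterMean, ← add_assoc]
    have hcons : ∀ ω : Ω, (fun w => A.phase (A.failSum k (R ++ ω :: w)) (ω :: w) R μ F Q) =
        fun w => if A.act (R ++ [ω]) μ ∈ Q then 0 else
        (∑ b ∈ avail F Q (A.act (R ++ [ω]) μ),
          A.phase (A.failSum k ((R ++ [ω]) ++ w)) w (R ++ [ω]) (A.next (R ++ [ω]) μ b)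
            {P ∈ F | A.act (R ++ [ω]) μ ∉ P} (insert b (insert (A.act (R ++ [ω]) μ) Q))) /
        #(avail F Q (A.act (R ++ [ω]) μ)) := by
      intro ω
      funext w
      rw [phase, List.append_assoc, List.singleton_append]
    have hle : ∀ ω : Ω, A.act (R ++ [ω]) μ ∉ Q → ∀ b ∈ avail F Q (A.act (R ++ [ω]) μ),
        A.failSum (k + T) (R ++ [ω]) (A.next (R ++ [ω]) μ b)
            {P ∈ F | A.act (R ++ [ω]) μ ∉ P} (insert b (insert (A.act (R ++ [ω]) μ) Q)) ≤
          iterMean T fun w => A.phase (A.failSum k ((R ++ [ω]) ++ w)) w (R ++ [ω])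
            (A.next (R ++ [ω]) μ b) {P ∈ F | A.act (R ++ [ω]) μ ∉ P}
            (insert b (insert (A.act (R ++ [ω]) μ) Q)) := by
      intro ω hω b hb
      refine ih _ _ _ _ ?_
      rw [card_insert_insert hω (mem_compl.1 hb)]
      have := card_le_card (GoodFamily.sup_filter_subset F (A.act (R ++ [ω]) μ ∉ ·))
      omega
    have hav : ∀ ω : Ω, 0 < #(avail F Q (A.act (R ++ [ω]) μ)) := fun ω =>
      hn.trans_le (le_card_avail _ (by omega))
    refine A.failSum_succ_le (k + T) R μ F Q _ (fun ω => ?_) fun ω hω => ?_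
    · rw [hcons]
      by_cases hω : A.act (R ++ [ω]) μ ∈ Q
      · simp only [if_pos hω, iterMean_zero, le_refl]
      · simp only [if_neg hω]
        rw [iterMean_sum]
        exact div_nonneg (Finset.sum_nonneg fun b hb =>
          (A.failSum_nonneg _ _ _ _ _).trans (hle ω hω b hb)) (Nat.cast_nonneg _)
    · rw [hcons]
      simp only [if_neg hω]
      rw [iterMean_sum]
      -- The best available reply is at least as good as the average one.
      obtain ⟨b, hb, hmin⟩ := Finset.exists_min_image (avail F Q (A.act (R ++ [ω]) μ))
        (fun b => A.failSum (k + T) (R ++ [ω]) (A.next (R ++ [ω]) μ b)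
            {P ∈ F | A.act (R ++ [ω]) μ ∉ P} (insert b (insert (A.act (R ++ [ω]) μ) Q)))
        (Finset.card_pos.1 (hav ω))
      refine ⟨b, mem_compl.1 hb, ?_⟩
      rw [le_div_iff₀ (by exact_mod_cast hav ω), mul_comm, ← nsmul_eq_mul]
      exact Finset.card_nsmul_le_sum _ _ _ fun b' hb' =>
        (hmin b' hb').trans (hle ω hω b' hb')

theorem phase_one_le [Fintype α] (A : Responder Ω M α) (w R : List Ω) (μ : M) (F : Finset (Finset α))
    (Q : Finset α) : A.phase (fun _ _ _ => 1) w R μ F Q ≤ 1 := by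
  induction w generalizing R μ F Q with
  | nil => simp [phase]
  | cons ω w ih =>
    rw [phase]
    split_ifs
    · exact zero_le_one
    · refine div_le_one_of_le₀ ?_ (Nat.cast_nonneg _)
      exact (Finset.sum_le_card_nsmul _ _ 1 fun b _ => ih _ _ _ _).trans (by simp)

open Classical in
/-- The probability that the elements `Q'` are declared during a phase. -/
theorem phase_weight_le [Fintype α] (A : Responder Ω M α) {n : ℕ} (hn : 0 < n) (μ' : M)
    (F' : Finset (Finset α)) (Q' : Finset α) (w R : List Ω) (μ : M) (F : Finset (Finset α))
    (Q : Finset α) (h : #(F.sup id) + #Q + 2 * w.length + n ≤ Fintype.card α) :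
    A.phase (fun μ F Q => if μ = μ' ∧ F = F' ∧ Q = Q' then 1 else 0) w R μ F Q ≤
      if Q ⊆ Q' then ((#Q' : ℝ) / n) ^ w.length else 0 := by
  induction w generalizing R μ F Q with
  | nil =>
    simp only [phase, List.length_nil, pow_zero]
    split_ifs with h1 h2
    · rfl
    · exact absurd h1.2.2.subset h2
    · exact zero_le_one
    · rfl
  | cons ω w ih =>
    rw [phase]
    split_ifs with hx hQ hQ
    · positivity
    · rfl
    · set x := A.act (R ++ [ω]) μ
      have hcard : n ≤ #(avail F Q x) := le_card_avail _ (by simp at h; omega)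
      have hn' : (0 : ℝ) < n := by exact_mod_cast hn
      have hsum : ∀ b ∈ avail F Q x,
          A.phase (fun μ F Q => if μ = μ' ∧ F = F' ∧ Q = Q' then 1 else 0) w (R ++ [ω])
            (A.next (R ++ [ω]) μ b) {P ∈ F | x ∉ P} (insert b (insert x Q)) ≤
          if b ∈ Q' then ((#Q' : ℝ) / n) ^ w.length else 0 := by
        intro b hb
        refine (ih _ _ _ _ ?_).trans ?_
        · rw [card_insert_insert hx (mem_compl.1 hb)]
          have := card_le_card (GoodFamily.sup_filter_subset F (x ∉ ·))
          simp only [List.length_cons] at h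
          omega
        · by_cases h1 : insert b (insert x Q) ⊆ Q'
          · rw [if_pos h1, if_pos (h1 (mem_insert_self _ _))]
          · rw [if_neg h1]
            positivity
      -- Bob's reply has to fall into `Q'`, and it is uniform among at least `n` numbers.
      calc _ ≤ (∑ b ∈ avail F Q x, if b ∈ Q' then ((#Q' : ℝ) / n) ^ w.length else 0) /
            #(avail F Q x) :=
            div_le_div_of_nonneg_right (Finset.sum_le_sum hsum) (Nat.cast_nonneg _)
        _ ≤ (#Q' * ((#Q' : ℝ) / n) ^ w.length) / n := by
            refine div_le_div₀ (by positivity) ?_ hn' (by exact_mod_cast hcard)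
            rw [← Finset.sum_filter, Finset.sum_const, nsmul_eq_mul]
            refine mul_le_mul_of_nonneg_right ?_ (by positivity)
            exact_mod_cast card_le_card fun b hb => (mem_filter.1 hb).2
        _ = _ := by rw [List.length_cons, pow_succ]; ring
    · refine le_of_eq ?_
      rw [Finset.sum_eq_zero, zero_div]
      intro b hb
      have hx' := card_insert_insert hx (mem_compl.1 hb)
      refine le_antisymm ((ih _ _ _ _ ?_).trans (le_of_eq (if_neg fun h1 => hQ ?_)))
        (A.phase_nonneg (fun _ _ _ => by split_ifs <;> norm_num) _ _ _ _ _)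
      · rw [hx']
        have := card_le_card (GoodFamily.sup_filter_subset F (A.act (R ++ [ω]) μ ∉ ·))
        simp only [List.length_cons] at h
        omega
      · exact ((subset_insert _ _).trans (subset_insert _ _)).trans h1

-- A phase is linear in its payoff, so the payoff may be expanded in indicators of final situations.
open Classical in
theorem phase_eq_sum [Fintype α] [Fintype M] (A : Responder Ω M α)
    (f : M → Finset (Finset α) → Finset α → ℝ) (w R : List Ω) (μ : M)
    (F : Finset (Finset α)) (Q : Finset α) :
    A.phase f w R μ F Q = ∑ μ', ∑ F', ∑ Q',
      A.phase (fun μ F Q => if μ = μ' ∧ F = F' ∧ Q = Q' then 1 else 0) w R μ F Q *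
        f μ' F' Q' := by
  induction w generalizing R μ F Q with
  | nil =>
    simp only [phase]
    simp [ite_and]
  | cons ω w ih =>
    simp only [phase]
    split_ifs with hx
    · simp
    · rw [Finset.sum_congr rfl fun b _ => ih _ _ _ _]
      simp only [div_mul_eq_mul_div, Finset.sum_mul, ← Finset.sum_div]
      congr 1
      rw [Finset.sum_comm]
      refine Finset.sum_congr rfl fun μ' _ => ?_
      rw [Finset.sum_comm]
      refine Finset.sum_congr rfl fun F' _ => ?_
      rw [Finset.sum_comm]

/-- What can be reached in a phase that starts from `F` and `Q`. -/
theorem phase_eq_zero_of_unreachable [Fintype α] (A : Responder Ω M α)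
    {f : M → Finset (Finset α) → Finset α → ℝ} (w R : List Ω) (μ : M)
    (F : Finset (Finset α)) (Q : Finset α) (hF : GoodFamily F) (hd : Disjoint Q (F.sup id))
    (h : ∀ μ' F' Q', F' ⊆ F → GoodFamily F' → Disjoint Q' (F'.sup id) →
      #Q' = #Q + 2 * w.length → f μ' F' Q' = 0) : A.phase f w R μ F Q = 0 := by
  induction w generalizing R μ F Q with
  | nil => exact h _ _ _ Subset.rfl hF hd (by simp)
  | cons ω w ih =>
    rw [phase]
    split_ifs with hx
    · rfl
    rw [Finset.sum_eq_zero, zero_div]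
    intro b hb
    have hb' := mem_compl.1 hb
    refine ih _ _ _ _ (hF.filter_notMem _) (disjoint_insert_insert hd hb')
      fun μ' F' Q' h1 h2 h3 h4 => h μ' F' Q' (h1.trans (filter_subset _ _)) h2 h3 ?_
    rw [h4, card_insert_insert hx hb', List.length_cons]
    ring

/-! ### Merging indistinguishable pasts -/

/-- Both pasts share `μ` and `R`, so Alice cannot tell them apart and they become worlds of one
family. Disjointness from `F.sup id` lets `P` and `Q` be read off from `P ∪ Q`, so no world is
counted twice. -/
theorem failSum_add_failSum [Fintype Ω] (A : Responder Ω M α) (k : ℕ) (R : List Ω) (μ : M)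
    (F : Finset (Finset α)) (Q₁ Q₂ : Finset α) (h₁ : Disjoint Q₁ (F.sup id))
    (h₂ : Disjoint Q₂ (F.sup id)) (hne : Q₁ ≠ Q₂) :
    A.failSum k R μ F Q₁ + A.failSum k R μ F Q₂ =
      A.failSum k R μ (F.image (· ∪ Q₁) ∪ F.image (· ∪ Q₂)) ∅ := by
  have hrec : ∀ Q : Finset α, Disjoint Q (F.sup id) → ∀ P ∈ F,
      (P ∪ Q) ∩ F.sup id = P ∧ (P ∪ Q) \ F.sup id = Q := by
    intro Q hQ P hP
    have hPF : P ⊆ F.sup id := Finset.le_sup (f := id) hP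
    rw [union_inter_distrib_right, inter_eq_left.2 hPF, disjoint_iff_inter_eq_empty.1 hQ,
      union_empty, union_sdiff_distrib, sdiff_eq_empty_iff_subset.2 hPF, empty_union,
      sdiff_eq_self_of_disjoint hQ]
    exact ⟨rfl, rfl⟩
  have hinj : ∀ Q : Finset α, Disjoint Q (F.sup id) → Set.InjOn (· ∪ Q) (F : Set (Finset α)) := by
    intro Q hQ P hP P' hP' h
    simp only at h
    rw [← (hrec Q hQ P hP).1, h, (hrec Q hQ P' hP').1]
  unfold failSum
  rw [Finset.sum_union, Finset.sum_image (hinj _ h₁), Finset.sum_image (hinj _ h₂)]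
  · simp only [union_empty]
  · rw [Finset.disjoint_left]
    intro X h1 h2
    obtain ⟨P, hP, rfl⟩ := mem_image.1 h1
    obtain ⟨P', hP', h⟩ := mem_image.1 h2
    apply hne
    rw [← (hrec Q₁ h₁ P hP).2, ← h, (hrec Q₂ h₂ P' hP').2]

/-- The error made in one phase of `T` rounds. -/
noncomputable def phaseError (M : Type*) [Fintype M] (n T s : ℕ) : ℝ :=
  Fintype.card M * 2 ^ 2 ^ s * ((2 * n + 1) * ((2 * T : ℝ) / n) ^ T * 2 ^ s)

theorem phaseError_nonneg (M : Type*) [Fintype M] (n T s : ℕ) : 0 ≤ phaseError M n T s := by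
  unfold phaseError
  positivity

/-- One phase halves the bound on `failSum`. -/
theorem phase_failSum_le [Fintype Ω] [Fintype α] [Fintype M] (A : Responder Ω M α) {n T s j : ℕ} (hn : 0 < n)
    (hα : Fintype.card α = 2 * n) (hj : j ≤ s) (k : ℕ) (w R R' : List Ω) (hw : w.length = T)
    (μ : M) (F : Finset (Finset α)) (hF : GoodFamily F)
    (hsup : #(F.sup id) + 2 * T ≤ n) (hcard : #F ≤ 2 ^ j) {a : ℝ} (ha : 0 ≤ a)
    (hpair : ∀ (μ' : M) (F' : Finset (Finset α)) (Q₁ Q₂ : Finset α), F' ⊆ F → GoodFamily F' →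
      Disjoint Q₁ (F'.sup id) → Disjoint Q₂ (F'.sup id) → #Q₁ = 2 * T → #Q₂ = 2 * T →
      Even #(Q₁ ∪ Q₂) →
      A.failSum k R' μ' (F'.image (· ∪ Q₁) ∪ F'.image (· ∪ Q₂)) ∅ ≤ a) :
    A.phase (A.failSum k R') w R μ F ∅ ≤ a / 2 + phaseError M n T s := by
  classical
  set W : M → Finset (Finset α) → Finset α → ℝ := fun μ' F' Q' =>
    A.phase (fun μ F Q => if μ = μ' ∧ F = F' ∧ Q = Q' then 1 else 0) w R μ F ∅ with hW
  have hW0 : ∀ μ' F' Q', 0 ≤ W μ' F' Q' := fun μ' F' Q' =>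
    A.phase_nonneg (fun _ _ _ => by split_ifs <;> norm_num) _ _ _ _ _
  have hreach : ∀ μ' F' Q', W μ' F' Q' ≠ 0 →
      F' ⊆ F ∧ GoodFamily F' ∧ Disjoint Q' (F'.sup id) ∧ #Q' = 2 * T := by
    intro μ' F' Q' h
    by_contra hcon
    refine h (A.phase_eq_zero_of_unreachable w R μ F ∅ hF (disjoint_empty_left _) ?_)
    intro μ₁ F₁ Q₁ h1 h2 h3 h4
    refine if_neg ?_
    rintro ⟨rfl, rfl, rfl⟩
    exact hcon ⟨h1, h2, h3, by rw [h4, hw]; simp⟩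
  have hWle : ∀ μ' F' Q', W μ' F' Q' ≤ ((2 * T : ℝ) / n) ^ T := by
    intro μ' F' Q'
    by_cases h : W μ' F' Q' = 0
    · rw [h]; positivity
    · have h1 := A.phase_weight_le hn μ' F' Q' w R μ F ∅ (by simp only [card_empty]; omega)
      rw [if_pos (empty_subset _), (hreach _ _ _ h).2.2.2, hw] at h1
      rw [Nat.cast_mul, Nat.cast_ofNat] at h1
      exact h1
  have hgroup : ∀ μ' F', F' ⊆ F → ∑ Q', W μ' F' Q' * A.failSum k R' μ' F' Q' ≤
      a / 2 * ∑ Q', W μ' F' Q' + (2 * n + 1) * ((2 * T : ℝ) / n) ^ T * 2 ^ s := by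
    intro μ' F' hF'
    have hsub : ∀ g : Finset α → ℝ,
        ∑ Q' with W μ' F' Q' ≠ 0, W μ' F' Q' * g Q' = ∑ Q', W μ' F' Q' * g Q' := by
      intro g
      rw [Finset.sum_filter]
      refine Finset.sum_congr rfl fun Q' _ => ?_
      split_ifs with h
      · rfl
      · rw [not_not.1 h, zero_mul]
    -- Only sets of positive weight are matched, since they have the required size and disjointness.
    -- The constants are the bound for families without an even union, the largest weight of one
    -- set, and the largest number of worlds.
    have key := sum_mul_le_of_exists_pair (univ.filter fun Q' => W μ' F' Q' ≠ 0)
      (A.failSum k R' μ' F') (2 * n + 1) (a := a) (b := 2 ^ s) (ω := ((2 * T : ℝ) / n) ^ T)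
      ha (by positivity) (by positivity) ?_ ?_ (W μ' F') (fun _ _ => hW0 _ _ _)
      (fun _ _ => hWle _ _ _)
    · have h1 := hsub fun _ => 1
      simp only [mul_one] at h1
      rw [hsub, h1] at key
      push_cast at key
      exact key
    · intro Q' _
      refine (A.failSum_le_card _ _ _ _ _).trans ?_
      exact_mod_cast (card_le_card hF').trans
        (hcard.trans (Nat.pow_le_pow_right (by norm_num) hj))
    · intro Y hY hlt
      by_contra! hcon
      have hr : ∀ Q ∈ Y, Disjoint Q (F'.sup id) ∧ #Q = 2 * T ∧ GoodFamily F' := fun Q hQ =>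
        have h := hreach μ' F' Q (mem_filter.1 (hY hQ)).2
        ⟨h.2.2.1, h.2.2.2, h.2.1⟩
      refine absurd (card_le_of_even_of_odd_inter Y (fun Q hQ => ?_) fun Q₁ h₁ Q₂ h₂ hne => ?_)
        (by rw [hα]; exact not_le.2 hlt)
      · rw [(hr Q hQ).2.1]; exact even_two_mul T
      · by_contra hev
        rw [Nat.not_odd_iff_even] at hev
        refine absurd (hpair μ' F' Q₁ Q₂ hF' (hr _ h₁).2.2 (hr _ h₁).1 (hr _ h₂).1 (hr _ h₁).2.1
          (hr _ h₂).2.1 ?_) (not_le.2 ?_)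
        -- The two sizes add up to `4 * T`, so union and intersection have the same parity.
        · have h := card_union_add_card_inter Q₁ Q₂
          rw [(hr _ h₁).2.1, (hr _ h₂).2.1] at h
          grind
        · rw [← A.failSum_add_failSum k R' μ' F' Q₁ Q₂ (hr _ h₁).1 (hr _ h₂).1 hne]
          exact hcon Q₁ h₁ Q₂ h₂ hne
  have hpow : ∀ (μ' : M) (g : Finset (Finset α) → Finset α → ℝ),
      ∑ F', ∑ Q', W μ' F' Q' * g F' Q' = ∑ F' ∈ F.powerset, ∑ Q', W μ' F' Q' * g F' Q' := by
    intro μ' g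
    refine (Finset.sum_subset (subset_univ _) fun F' _ hF' => ?_).symm
    refine Finset.sum_eq_zero fun Q' _ => ?_
    by_contra h
    exact hF' (mem_powerset.2 (hreach μ' F' Q' (left_ne_zero_of_mul h)).1)
  have htotal : ∑ μ', ∑ F' ∈ F.powerset, ∑ Q', W μ' F' Q' ≤ 1 := by
    have h1 := A.phase_one_le w R μ F ∅
    rw [phase_eq_sum] at h1
    rw [Finset.sum_congr rfl fun μ' _ => hpow μ' fun _ _ => 1] at h1
    simpa using h1
  have hcnt : (#F.powerset : ℝ) ≤ 2 ^ 2 ^ s := by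
    rw [card_powerset]
    exact_mod_cast Nat.pow_le_pow_right (by norm_num)
      (hcard.trans (Nat.pow_le_pow_right (by norm_num) hj))
  rw [phase_eq_sum]
  calc _ = ∑ μ', ∑ F' ∈ F.powerset, ∑ Q', W μ' F' Q' * A.failSum k R' μ' F' Q' :=
        Finset.sum_congr rfl fun μ' _ => hpow μ' fun F' Q' => A.failSum k R' μ' F' Q'
    _ ≤ ∑ μ' : M, ∑ F' ∈ F.powerset, (a / 2 * ∑ Q', W μ' F' Q' +
          (2 * n + 1) * ((2 * T : ℝ) / n) ^ T * 2 ^ s) :=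
        Finset.sum_le_sum fun μ' _ => Finset.sum_le_sum fun F' hF' =>
          hgroup μ' F' (mem_powerset.1 hF')
    _ = a / 2 * (∑ μ', ∑ F' ∈ F.powerset, ∑ Q', W μ' F' Q') +
          Fintype.card M * #F.powerset * ((2 * n + 1) * ((2 * T : ℝ) / n) ^ T * 2 ^ s) := by
        simp only [Finset.sum_add_distrib, ← Finset.mul_sum, Finset.sum_const, nsmul_eq_mul,
          card_univ]
        ring
    _ ≤ a / 2 * 1 + phaseError M n T s := by
        refine add_le_add (mul_le_mul_of_nonneg_left htotal (by linarith)) ?_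
        unfold phaseError
        gcongr
    _ = _ := by ring

/-- After `i` further phases the failure probabilities sum to about `2⁻ⁱ`. -/
theorem failSum_le_of_phases [Fintype Ω] [Fintype α] [Nonempty Ω] [Fintype M] (A : Responder Ω M α) {n T s : ℕ}
    (hn : 0 < n) (hα : Fintype.card α = 2 * n) (hs : 4 * T * s ≤ n) (i j k : ℕ)
    (hij : i + j = s) (R : List Ω) (μ : M) (F : Finset (Finset α)) (hF : GoodFamily F)
    (hsup : #(F.sup id) ≤ 4 * T * j) (hcard : #F ≤ 2 ^ j) (hP : ∀ P ∈ F, #P = 2 * T * j)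
    (hk : T * s + k = n) :
    A.failSum (k + T * i) R μ F ∅ ≤ (1 / 2) ^ i + i * phaseError M n T s := by
  induction i generalizing j R μ F with
  | zero =>
    -- All phases are over: each world has `2 * T * s` elements, and the `k` rounds left use up the
    -- other numbers.
    have hjs : j = s := by omega
    subst hjs
    refine (A.failSum_le_one (by rw [hα]; exact even_two_mul n) _ R μ F ∅ hF
      (disjoint_empty_left _) (by simp) fun P hPF => ?_).trans (by simp)
    rw [hP P hPF, hα, card_empty, ← hk]
    ring
  | succ i ih =>
    -- A phase adds two sets of size `2 * T` to the union, so `4 * T * s ≤ n` keeps `n` numbers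
    -- available throughout.
    have hbud : #(F.sup id) + 2 * T ≤ n := by
      have : 4 * T * (j + 1) ≤ 4 * T * s := Nat.mul_le_mul_left _ (by omega)
      have : 4 * T * (j + 1) = 4 * T * j + 4 * T := by ring
      omega
    have herr := phaseError_nonneg M n T s
    rw [mul_add, mul_one, ← add_assoc]
    refine (A.failSum_le_iterMean_phase (k + T * i) T hn R μ F ∅
      (by rw [hα, card_empty]; omega)).trans (iterMean_le T _ _ fun w hw => ?_)
    refine (A.phase_failSum_le hn hα (show j ≤ s by omega) (k + T * i) w R (R ++ w) hw μ F hF hbud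
      hcard (a := (1 / 2) ^ i + i * phaseError M n T s) (by positivity) ?_).trans ?_
    · intro μ' F' Q₁ Q₂ hF' hg h₁ h₂ c₁ c₂ hev
      refine ih (j + 1) (by omega) (R ++ w) μ' _
        (hg.pair hev (by rw [c₁]; exact even_two_mul T) (by rw [c₂]; exact even_two_mul T) h₁ h₂)
        ?_ ?_ ?_
      · refine (card_le_card (GoodFamily.sup_image_union_le F' Q₁ Q₂)).trans ?_
        refine (card_union_le _ _).trans ?_
        have h3 := card_union_le Q₁ Q₂
        have h4 : #(F'.sup id) ≤ #(F.sup id) := card_le_card (Finset.sup_mono hF')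
        have : 4 * T * (j + 1) = 4 * T * j + 4 * T := by ring
        omega
      · refine (card_union_le _ _).trans ?_
        have h1 := card_image_le (s := F') (f := (· ∪ Q₁))
        have h2 := card_image_le (s := F') (f := (· ∪ Q₂))
        have h3 := card_le_card hF'
        rw [pow_succ]
        omega
      · have hone : ∀ Q : Finset α, Disjoint Q (F'.sup id) → #Q = 2 * T → ∀ P ∈ F',
            #(P ∪ Q) = 2 * T * (j + 1) := by
          intro Q hQ hQc P hPF
          have hPQ : Disjoint P Q := (hQ.mono_right (Finset.le_sup (f := id) hPF)).symm
          rw [card_union_of_disjoint hPQ, hQc, hP P (hF' hPF)]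
          ring
        intro P hPF
        rcases mem_union.1 hPF with h | h
        · obtain ⟨P', hP', rfl⟩ := mem_image.1 h
          exact hone _ h₁ c₁ _ hP'
        · obtain ⟨P', hP', rfl⟩ := mem_image.1 h
          exact hone _ h₂ c₂ _ hP'
    · push_cast
      rw [pow_succ]
      have : 0 ≤ (i : ℝ) * phaseError M n T s := by positivity
      linarith

end Responder

end

/-! ### The mirror game as a game against a responder -/

namespace MirrorGame

open scoped ENNReal

variable {n m ℓ : ℕ}

theorem AliceLoses.append {h : List (Number n)} (hh : AliceLoses h) (t : List (Number n)) :
    AliceLoses (h ++ t) := by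
  obtain ⟨i, hi, hnd, a, ha, hmem⟩ := hh
  have hlt : i < h.length := (List.getElem?_eq_some_iff.1 ha).1
  have htake : (h ++ t).take i = h.take i := List.take_append_of_le_length hlt.le
  exact ⟨i, hi, by rwa [htake], a, by rwa [List.getElem?_append_left hlt], by rwa [htake]⟩

theorem aliceLoses_append_singleton {h : List (Number n)} (hnd : h.Nodup)
    (he : Even h.length) {a : Number n} (ha : a ∈ h) : AliceLoses (h ++ [a]) :=
  ⟨h.length, he, by simpa using hnd, a, by simp, by simpa using ha⟩

/-- The situation after a move of Bob. -/
def bobTurn (s : State n m ℓ) (b : Number n) : State n m ℓ :=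
  { s with moves := s.moves ++ [b] }

open Classical in
/-- The least probability with which Bob can fail to beat Alice in the next rounds. -/
noncomputable def value (A : AliceStrategy n m ℓ) : ℕ → State n m ℓ → ℝ
  | 0, s => if AliceLoses s.moves then 0 else 1
  | k + 1, s => (∑ r, ⨅ b, value A k (bobTurn (aliceTurn A s r) b)) / Fintype.card (Bits ℓ)

theorem value_nonneg (A : AliceStrategy n m ℓ) (k : ℕ) (s : State n m ℓ) : 0 ≤ value A k s := by
  induction k generalizing s with
  | zero => rw [value]; split_ifs <;> norm_num
  | succ k ih =>
    exact div_nonneg (Finset.sum_nonneg fun r _ => Real.iInf_nonneg fun b => ih _)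
      (Nat.cast_nonneg _)

theorem iInf_value_le (A : AliceStrategy n m ℓ) (k : ℕ) (s : State n m ℓ) (b : Number n) :
    ⨅ b, value A k (bobTurn s b) ≤ value A k (bobTurn s b) :=
  ciInf_le (Set.finite_range _).bddBelow b

theorem value_le_one (A : AliceStrategy n m ℓ) (hn : 0 < n) (k : ℕ) (s : State n m ℓ) :
    value A k s ≤ 1 := by
  induction k generalizing s with
  | zero => rw [value]; split_ifs <;> norm_num
  | succ k ih =>
    refine div_le_one_of_le₀ ?_ (Nat.cast_nonneg _)
    refine (Finset.sum_le_card_nsmul _ _ 1 fun r _ =>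
      (iInf_value_le A k _ ⟨0, by omega⟩).trans (ih _)).trans (by simp)

theorem value_eq_zero (A : AliceStrategy n m ℓ) (hn : 0 < n) (k : ℕ) (s : State n m ℓ)
    (hs : AliceLoses s.moves) : value A k s = 0 := by
  induction k generalizing s with
  | zero => rw [value, if_pos hs]
  | succ k ih =>
    rw [value, Finset.sum_eq_zero, zero_div]
    intro r _
    refine le_antisymm ((iInf_value_le A k _ ⟨0, by omega⟩).trans (le_of_eq (ih _ ?_)))
      (Real.iInf_nonneg fun b => value_nonneg _ _ _)
    exact (hs.append _).append _

/-- The new memory state of Alice, from the old one and the last move of Bob, if any. -/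
def newMem (A : AliceStrategy n m ℓ) (R : List (Bits ℓ)) (μ : Bits m × Option (Number n)) :
    Bits m :=
  match μ.2 with
  | none => μ.1
  | some b => A.upd b μ.1 R

/-- Alice, as a player whose memory includes the last move of Bob. -/
def AliceStrategy.responder (A : AliceStrategy n m ℓ) :
    Responder (Bits ℓ) (Bits m × Option (Number n)) (Number n) where
  act R μ := A.nxt (newMem A R μ) R
  next R μ b := (newMem A R μ, some b)

theorem mem_aliceTurn (A : AliceStrategy n m ℓ) (s : State n m ℓ) (r : Bits ℓ) :
    (aliceTurn A s r).mem = newMem A (s.rand ++ [r]) (s.mem, s.moves.getLast?) := by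
  rfl

theorem moves_aliceTurn (A : AliceStrategy n m ℓ) (s : State n m ℓ) (r : Bits ℓ) :
    (aliceTurn A s r).moves =
      s.moves ++ [A.responder.act (s.rand ++ [r]) (s.mem, s.moves.getLast?)] := by
  rfl

/-- `fail` is the more pessimistic count: it charges Bob in full for repeating a number and for
reaching the end, and agrees that he has won once Alice repeats first. -/
theorem value_le_fail (A : AliceStrategy n m ℓ) (hn : 0 < n) (k : ℕ) (s : State n m ℓ)
    (hnd : s.moves.Nodup) (he : Even s.moves.length) :
    value A k s ≤
      A.responder.fail k s.rand (s.mem, s.moves.getLast?) s.moves.toFinset := by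
  induction k generalizing s with
  | zero => exact value_le_one A hn 0 s
  | succ k ih =>
    have : Nonempty (Number n) := ⟨⟨0, by omega⟩⟩
    rw [value, Responder.fail]
    refine div_le_div_of_nonneg_right (Finset.sum_le_sum fun r _ => ?_) (Nat.cast_nonneg _)
    set x := A.responder.act (s.rand ++ [r]) (s.mem, s.moves.getLast?) with hx
    split_ifs with h
    · refine (iInf_value_le A k _ ⟨0, by omega⟩).trans (le_of_eq (value_eq_zero A hn k _ ?_))
      exact (aliceLoses_append_singleton hnd he (List.mem_toFinset.1 h)).append _
    · refine le_ciInf fun b => (iInf_value_le A k _ b).trans ?_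
      split_ifs with hb
      · exact value_le_one A hn k _
      have hmoves : (bobTurn (aliceTurn A s r) b).moves = s.moves ++ [x] ++ [b] := rfl
      have hset : (s.moves ++ [x] ++ [b]).toFinset = insert b (insert x s.moves.toFinset) := by
        ext y
        simp only [List.mem_toFinset, List.mem_append, List.mem_singleton, Finset.mem_insert]
        tauto
      refine (ih _ ?_ ?_).trans (le_of_eq ?_)
      · rw [hmoves]
        rw [List.mem_toFinset] at h
        simp only [Finset.mem_insert, List.mem_toFinset, not_or] at hb
        refine List.Nodup.append (List.Nodup.append hnd (List.nodup_singleton _) ?_)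
          (List.nodup_singleton _) ?_
        · simpa using h
        · simp only [List.disjoint_singleton, List.mem_append, List.mem_singleton, not_or]
          exact ⟨hb.2, hb.1⟩
      · rw [hmoves, List.length_append, List.length_append]
        simpa [add_assoc] using he.add even_two
      · rw [hmoves, hset, List.getLast?_concat]
        rfl

/-! ### The optimal strategy of Bob attains the value -/

/-- The memory state of Alice after `k` rounds, recomputed from the random strings and moves. -/
def replay (A : AliceStrategy n m ℓ) (R : List (Bits ℓ)) (M : List (Number n)) : ℕ → Bits m
  | 0 => A.init
  | k + 1 => newMem A (R.take (k + 1)) (replay A R M k, (M.take (2 * k)).getLast?)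

/-- A move of Bob that minimizes the value. -/
noncomputable def bestMove (A : AliceStrategy n m ℓ) (k : ℕ) (s : State n m ℓ)
    [Nonempty (Number n)] : Number n :=
  (exists_eq_ciInf_of_finite (f := fun b => value A k (bobTurn s b))).choose

theorem value_bestMove (A : AliceStrategy n m ℓ) (k : ℕ) (s : State n m ℓ)
    [Nonempty (Number n)] :
    value A k (bobTurn s (bestMove A k s)) = ⨅ b, value A k (bobTurn s b) :=
  (exists_eq_ciInf_of_finite (f := fun b => value A k (bobTurn s b))).choose_spec

/-- The optimal strategy of Bob. -/
noncomputable def bestStrategy (A : AliceStrategy n m ℓ) [Nonempty (Number n)] :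
    BobStrategy n ℓ := fun R M =>
  PMF.pure (bestMove A (n - R.length) { rand := R, moves := M, mem := replay A R M R.length })

/-- What holds for a situation after `k` rounds. -/
structure Reachable (A : AliceStrategy n m ℓ) (k : ℕ) (s : State n m ℓ) : Prop where
  length_rand : s.rand.length = k
  length_moves : s.moves.length = 2 * k
  -- `replay` reads only initial segments; allowing arbitrary continuations makes the identity
  -- survive later rounds.
  mem_eq : ∀ R M, s.mem = replay A (s.rand ++ R) (s.moves ++ M) k

theorem Reachable.mem_aliceTurn {A : AliceStrategy n m ℓ} {k : ℕ} {s : State n m ℓ}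
    (hs : Reachable A k s) (r : Bits ℓ) (R : List (Bits ℓ)) (M : List (Number n)) :
    (aliceTurn A s r).mem =
      replay A ((aliceTurn A s r).rand ++ R) ((aliceTurn A s r).moves ++ M) (k + 1) := by
  have h1 : (aliceTurn A s r).rand ++ R = s.rand ++ ([r] ++ R) := by
    simp [aliceTurn]
  rw [moves_aliceTurn, h1, List.append_assoc, replay, ← hs.mem_eq,
    List.take_left' hs.length_moves, MirrorGame.mem_aliceTurn, ← List.append_assoc,
    List.take_left' (by simp [hs.length_rand])]

theorem Reachable.bobTurn {A : AliceStrategy n m ℓ} {k : ℕ} {s : State n m ℓ}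
    (hs : Reachable A k s) (r : Bits ℓ) (b : Number n) :
    Reachable A (k + 1) (bobTurn (aliceTurn A s r) b) where
  length_rand := by simp [MirrorGame.bobTurn, aliceTurn, hs.length_rand]
  length_moves := by simp [MirrorGame.bobTurn, aliceTurn, hs.length_moves]; ring
  mem_eq R M := by
    simp only [MirrorGame.bobTurn, List.append_assoc]
    exact hs.mem_aliceTurn r R ([b] ++ M)

theorem round_bestStrategy (A : AliceStrategy n m ℓ) [Nonempty (Number n)] {k : ℕ}
    {s : State n m ℓ} (hs : Reachable A k s) :
    round A (bestStrategy A) s = (PMF.uniformOfFintype (Bits ℓ)).bind fun r =>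
      PMF.pure (MirrorGame.bobTurn (aliceTurn A s r)
        (bestMove A (n - (k + 1)) (aliceTurn A s r))) := by
  unfold round
  congr 1
  funext r
  have hlen : (aliceTurn A s r).rand.length = k + 1 := by simp [aliceTurn, hs.length_rand]
  have hmem := hs.mem_aliceTurn r [] []
  rw [List.append_nil, List.append_nil] at hmem
  simp only [bestStrategy, PMF.pure_map, hlen, ← hmem]
  rfl

theorem reachable_of_mem_support_play (A : AliceStrategy n m ℓ) [Nonempty (Number n)] (k : ℕ)
    (s : State n m ℓ) (hs : s ∈ (play A (bestStrategy A) k).support) : Reachable A k s := by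
  induction k generalizing s with
  | zero =>
    rw [play, PMF.support_pure, Set.mem_singleton_iff] at hs
    subst hs
    exact ⟨rfl, rfl, fun _ _ => rfl⟩
  | succ k ih =>
    rw [play, PMF.mem_support_bind_iff] at hs
    obtain ⟨t, ht, hst⟩ := hs
    rw [round_bestStrategy A (ih t ht), PMF.mem_support_bind_iff] at hst
    obtain ⟨r, _, hr⟩ := hst
    rw [PMF.support_pure, Set.mem_singleton_iff] at hr
    rw [hr]
    exact (ih t ht).bobTurn r _

theorem tsum_bind_mul {α β : Type*} (p : PMF α) (q : α → PMF β) (f : β → ℝ≥0∞) :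
    ∑' b, p.bind q b * f b = ∑' a, p a * ∑' b, q a b * f b := by
  simp only [PMF.bind_apply, ← ENNReal.tsum_mul_right, ← ENNReal.tsum_mul_left]
  rw [ENNReal.tsum_comm]
  simp only [mul_assoc]

theorem tsum_pure_mul {α : Type*} (a : α) (f : α → ℝ≥0∞) :
    ∑' b, PMF.pure a b * f b = f a := by
  rw [tsum_eq_single a fun b hb => by simp [PMF.pure_apply, hb]]
  simp [PMF.pure_apply]

/-- The chosen move attains the infimum, so the value is preserved in expectation. -/
theorem tsum_round_mul_value (A : AliceStrategy n m ℓ) [Nonempty (Number n)] {k : ℕ}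
    (hk : k < n) {s : State n m ℓ} (hs : Reachable A k s) :
    ∑' t, round A (bestStrategy A) s t * ENNReal.ofReal (value A (n - (k + 1)) t) =
      ENNReal.ofReal (value A (n - k) s) := by
  rw [round_bestStrategy A hs, tsum_bind_mul]
  simp only [tsum_pure_mul, value_bestMove]
  obtain ⟨d, hd⟩ : ∃ d, n - k = d + 1 := ⟨n - k - 1, by omega⟩
  have hd' : n - (k + 1) = d := by omega
  rw [hd, hd', value, ENNReal.ofReal_div_of_pos (by exact_mod_cast Fintype.card_pos),
    ENNReal.ofReal_sum_of_nonneg fun r _ => Real.iInf_nonneg fun b => value_nonneg _ _ _,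
    tsum_fintype, ENNReal.ofReal_natCast, div_eq_mul_inv, mul_comm, Finset.mul_sum]
  simp only [PMF.uniformOfFintype_apply]

theorem tsum_play_mul_value (A : AliceStrategy n m ℓ) [Nonempty (Number n)] (k : ℕ) (hk : k ≤ n) :
    ∑' s, play A (bestStrategy A) k s * ENNReal.ofReal (value A (n - k) s) =
      ENNReal.ofReal (value A n { rand := [], moves := [], mem := A.init }) := by
  induction k with
  | zero => rw [play, tsum_pure_mul, Nat.sub_zero]
  | succ k ih =>
    rw [← ih (by omega), play, tsum_bind_mul]
    refine tsum_congr fun s => ?_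
    by_cases hs : play A (bestStrategy A) k s = 0
    · rw [hs, zero_mul, zero_mul]
    · rw [tsum_round_mul_value A (by omega)
        (reachable_of_mem_support_play A k s ((PMF.mem_support_iff _ _).2 hs))]

/-- Against the optimal strategy of Bob, Alice loses with probability one minus the value. -/
theorem probAliceLoses_bestStrategy (A : AliceStrategy n m ℓ) [Nonempty (Number n)] :
    probAliceLoses A (bestStrategy A) =
      1 - value A n { rand := [], moves := [], mem := A.init } := by
  classical
  set v := value A n { rand := [], moves := [], mem := A.init }
  have h1 := tsum_play_mul_value A n le_rfl
  have h2 : (play A (bestStrategy A) n).toOuterMeasure {s | AliceLoses s.moves} +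
      ENNReal.ofReal v = 1 := by
    rw [← h1, PMF.toOuterMeasure_apply, ← ENNReal.tsum_add,
      ← (play A (bestStrategy A) n).tsum_coe]
    refine tsum_congr fun s => ?_
    rw [Nat.sub_self, value]
    by_cases hs : AliceLoses s.moves <;> simp [Set.indicator, hs]
  have hne : (play A (bestStrategy A) n).toOuterMeasure {s | AliceLoses s.moves} ≠ ⊤ :=
    ne_top_of_le_ne_top ENNReal.one_ne_top (h2 ▸ le_self_add)
  have h3 := congrArg ENNReal.toReal h2
  rw [ENNReal.toReal_add hne ENNReal.ofReal_ne_top, ENNReal.toReal_ofReal (value_nonneg _ _ _),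
    ENNReal.toReal_one] at h3
  unfold probAliceLoses
  linarith

theorem one_sub_le_probAliceLoses {T s : ℕ} (hn : 0 < n) (hs : 4 * T * s ≤ n)
    (A : AliceStrategy n m ℓ) [Nonempty (Number n)] :
    1 - (1 / 2) ^ s - s * ((2 ^ m * (2 * n + 1)) * 2 ^ 2 ^ s *
      ((2 * n + 1) * ((2 * T : ℝ) / n) ^ T * 2 ^ s)) ≤ probAliceLoses A (bestStrategy A) := by
  rw [probAliceLoses_bestStrategy]
  obtain ⟨k, hk⟩ : ∃ k, k + T * s = n := ⟨n - T * s, Nat.sub_add_cancel (by nlinarith)⟩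
  have h1 := value_le_fail A hn n { rand := [], moves := [], mem := A.init }
    List.nodup_nil (by simp)
  -- The start is the single world `∅`, so `failSum` is just Bob's failure probability.
  have h2 := A.responder.failSum_le_of_phases hn (by simp) hs s 0 k (by simp) []
    (A.init, none) {∅} .singleton (by simp) (by simp) (by simp) (by rw [add_comm, hk])
  rw [hk, Responder.failSum, Finset.sum_singleton, Finset.empty_union, Responder.phaseError] at h2
  simp only [Fintype.card_prod, Fintype.card_option, Fintype.card_pi, Fintype.card_bool,
    Finset.prod_const, Finset.card_univ, Fintype.card_fin, Nat.cast_mul, Nat.cast_pow,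
    Nat.cast_add, Nat.cast_ofNat, Nat.cast_one] at h2
  simp only [List.getLast?_nil, List.toFinset_nil] at h1
  linarith

end MirrorGame

/-! ### Asymptotics and choice of parameters -/

theorem negligible_mul_sq_mul_pow (C : ℝ) {γ : ℝ} (h0 : 0 ≤ γ) (h1 : γ < 1) :
    Negligible fun n => C * (2 * n + 1) ^ 2 * γ ^ (2 * n) := by
  intro k _
  have hγ : |γ ^ 2| < 1 := by
    rw [abs_of_nonneg (by positivity)]
    exact pow_lt_one₀ h0 h1 two_ne_zero
  have ht : Filter.Tendsto (fun n : ℕ => |C| * 9 * ((n : ℝ) ^ (k + 2) * (γ ^ 2) ^ n))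
      Filter.atTop (nhds 0) := by
    simpa using (tendsto_pow_const_mul_const_pow_of_abs_lt_one (k + 2) hγ).const_mul (|C| * 9)
  obtain ⟨N, hN⟩ := Filter.eventually_atTop.1 (ht.eventually (gt_mem_nhds one_pos))
  refine ⟨N, fun x hx => ?_⟩
  have hx1 : (1 : ℝ) ≤ x := by exact_mod_cast (Nat.zero_le N).trans_lt hx
  rw [lt_div_iff₀ (by positivity), abs_mul, abs_mul,
    abs_of_nonneg (show (0 : ℝ) ≤ (2 * x + 1) ^ 2 by positivity),
    abs_of_nonneg (show (0 : ℝ) ≤ γ ^ (2 * x) by positivity)]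
  refine lt_of_le_of_lt ?_ (hN x hx.le)
  have h9 : (2 * (x : ℝ) + 1) ^ 2 ≤ 9 * (x : ℝ) ^ 2 := by nlinarith
  calc |C| * (2 * (x : ℝ) + 1) ^ 2 * γ ^ (2 * x) * (x : ℝ) ^ k
      ≤ |C| * (9 * (x : ℝ) ^ 2) * γ ^ (2 * x) * (x : ℝ) ^ k := by gcongr
    _ = |C| * 9 * ((x : ℝ) ^ (k + 2) * (γ ^ 2) ^ x) := by rw [pow_mul, pow_add]; ring

theorem mainTheorem2 (c : ℕ) (hc : 2 ≤ c) (hceven : Even c) (β δ : ℝ)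
    (hβ : ((1 : ℝ) / c) ^ ((1 : ℝ) / (4 * c)) < β) (hβ1 : β < 1)
    (hδ0 : 0 < δ) (hδ1 : δ < 1) (hδβ : (2 : ℝ) ^ δ * β < 1) :
    ∃ ν : ℕ → ℝ, Negligible ν ∧
      ∀ n : ℕ, 0 < n → c ∣ n → Even (n / c) →
        ∀ m ℓ : ℕ, (m : ℝ) ≤ δ * (2 * n) →
          ∀ A : MirrorGame.AliceStrategy n m ℓ, ∃ B : MirrorGame.BobStrategy n ℓ,
            1 - (((n : ℝ) + 1) / (2 * n + 1)) ^ (c / 2) - ν n ≤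
              MirrorGame.probAliceLoses A B := by
  have hc0 : (0 : ℝ) < c := by exact_mod_cast (show 0 < c by omega)
  have hβ0 : 0 < β := (by positivity : (0 : ℝ) ≤ (1 / c : ℝ) ^ (1 / (4 * c) : ℝ)).trans_lt hβ
  obtain ⟨s, hs⟩ := hceven.two_dvd
  have hcs : c / 2 = s := by omega
  refine ⟨_, negligible_mul_sq_mul_pow (s * (2 ^ 2 ^ s * 2 ^ s))
    (by positivity : 0 ≤ (2 : ℝ) ^ δ * β) hδβ, ?_⟩
  intro n hn hcn heven m ℓ hm A
  -- With this `T` and `s = c / 2` the budget is met exactly: `4 * T * s = n`.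
  obtain ⟨T, hT⟩ := heven.two_dvd
  have hnc : n = 2 * T * c := by rw [← hT, Nat.div_mul_cancel hcn]
  have : Nonempty (MirrorGame.Number n) := ⟨⟨0, by omega⟩⟩
  have hn0 : (0 : ℝ) < n := by exact_mod_cast hn
  refine ⟨MirrorGame.bestStrategy A, le_trans ?_
    (MirrorGame.one_sub_le_probAliceLoses (T := T) (s := s) hn
      (by rw [hnc, hs]; exact le_of_eq (by ring)) A)⟩
  have hhalf : (1 / 2 : ℝ) ^ s ≤ (((n : ℝ) + 1) / (2 * n + 1)) ^ (c / 2) := by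
    rw [hcs]
    refine pow_le_pow_left₀ (by norm_num) ?_ s
    rw [div_le_div_iff₀ (by norm_num) (by positivity)]
    linarith
  have hmem : (2 : ℝ) ^ m ≤ ((2 : ℝ) ^ δ) ^ (2 * n) := by
    rw [← Real.rpow_natCast, ← Real.rpow_natCast, ← Real.rpow_mul (by norm_num)]
    refine Real.rpow_le_rpow_of_exponent_le (by norm_num) ?_
    push_cast
    exact hm
  have hprob : ((2 * T : ℝ) / n) ^ T ≤ β ^ (2 * n) := by
    have hT0 : (T : ℝ) ≠ 0 := by
      rintro h
      rw [Nat.cast_eq_zero] at h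
      subst h
      omega
    have h1 : (2 * T : ℝ) / n = 1 / c := by
      rw [hnc]
      push_cast
      field_simp
    -- The exponent `1 / (4 * c)` in the bound on `β` comes from `2 * n / (4 * c) = T`.
    have h2 : ((1 / c : ℝ) ^ (1 / (4 * c) : ℝ)) ^ (2 * n) = (1 / c : ℝ) ^ T := by
      rw [← Real.rpow_natCast, ← Real.rpow_mul (by positivity), ← Real.rpow_natCast]
      congr 1
      rw [hnc]
      push_cast
      field_simp
      ring
    rw [h1, ← h2]
    exact pow_le_pow_left₀ (by positivity) hβ.le _
  have herr : s * ((2 ^ m * (2 * n + 1)) * 2 ^ 2 ^ s *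
      ((2 * n + 1) * ((2 * T : ℝ) / n) ^ T * 2 ^ s)) ≤
      s * (2 ^ 2 ^ s * 2 ^ s) * (2 * n + 1) ^ 2 * ((2 : ℝ) ^ δ * β) ^ (2 * n) := by
    calc _ = s * (2 ^ 2 ^ s * 2 ^ s) * (2 * n + 1) ^ 2 *
          ((2 : ℝ) ^ m * ((2 * T : ℝ) / n) ^ T) := by ring
      _ ≤ s * (2 ^ 2 ^ s * 2 ^ s) * (2 * n + 1) ^ 2 *
          (((2 : ℝ) ^ δ) ^ (2 * n) * β ^ (2 * n)) := by gcongr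
      _ = _ := by rw [mul_pow]
  linarith
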